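/- Let $n\ge 0$, let $V=\mathbf C^{n+2}$ with coordinates $x_0,\dots,x_{n+1}$, let $V'=\{x_0=0\}\subset V$, let $\mathbf P^{n+1}=\mathbf P(V)$ with hyperplane at infinity $\mathbf P_\infty=\mathbf P(V')$, and let $Q$ be a nondegenerate quadratic form on $V'$. Let $X=\{F=0\}\subset\mathbf P^{n+1}$ be a (reduced) hypersurface none of whose components is $\mathbf P_\infty$: $F$ is a squarefree homogeneous polynomial of positive degree that is not divisible by $x_0$ (for instance, $F$ is irreducible and $X\neq\mathbf P_\infty$). For a smooth point $x$ of $X$ let $T_xX\subset V$ be the linear hyperplane whose projectivization is the projective tangent space of $X$ at $x$. For a smooth point $x\in X\setminus\mathbf P_\infty$ let the normal line $N_x(X)\subset\mathbf P^{n+1}$ be the join of $x$ with the projectivization of the subspace of $V'$ that is $Q$-orthogonal to $T_xX\cap V'$. Let $N_X$ be the Zariski closure in $\mathbf P^{n+1}\times\mathbf P^{n+1}$ of the set of pairs $(x,y)$ with $x$ a smooth point of $X$, $x\notin\mathbf P_\infty$, and $y\in N_x(X)$, and let the endpoint map $\pi:N_X\to\mathbf P^{n+1}$ be the second projection. $X$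 is called isotropically focally degenerate if $\pi$ is not dominant, i.e. if its image is not Zariski dense. Theorem. $X$ is isotropically focally degenerate if and only if it is isotropically developable, i.e. if and only if for each smooth point $x\in X\setminus\mathbf P_\infty$ the normal line $N_x(X)$ is contained in $X$ and the tangent space of $X$ does not vary along this line: $T_yX=T_xX$ for every smooth point $y$ of $X$ on $N_x(X)$. -/

import Mathlib

namespace FocalLoci

open MvPolynomial LinearAlgebra.Projectivization

noncomputable section

/-- The vector space `V = V' ⊕ ℂ` of dimension `n + 2`; the coordinate with index `0` is the
one that cuts out the hyperplane at infinity. -/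
abbrev Vec (n : ℕ) : Type := Fin (n + 2) → ℂ

/-- The projective space `P^{n+1}` of lines in `V`. -/
abbrev PSpace (n : ℕ) : Type := ℙ ℂ (Vec n)

/-- The vector space `V'` of dimension `n + 1`, as the hyperplane `x₀ = 0` of `V`. -/
abbrev VInf (n : ℕ) : Submodule ℂ (Vec n) :=
  LinearMap.ker (LinearMap.proj 0 : Vec n →ₗ[ℂ] ℂ)

/-- The hypersurface `{F = 0}` of `P^{n+1}` (used for homogeneous `F`, for which the choice of
representative vectors is irrelevant, here and below). -/
def hypersurface {n : ℕ} (F : MvPolynomial (Fin (n + 2)) ℂ) : Set (PSpace n) :=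
  {x | eval x.rep F = 0}

/-- The Zariski closure of a subset of `P^{n+1}`: the common zeros of all homogeneous
polynomials that vanish on it. -/
def zariskiClosure {n : ℕ} (S : Set (PSpace n)) : Set (PSpace n) :=
  {x | ∀ (d : ℕ) (G : MvPolynomial (Fin (n + 2)) ℂ), G.IsHomogeneous d →
    (∀ y ∈ S, eval y.rep G = 0) → eval x.rep G = 0}

/-- The bidegree of the variables of `ℂ[x, y]`: the `x i` have bidegree `(1, 0)`, the `y i` have
bidegree `(0, 1)`. -/
def bidegree (n : ℕ) : Fin (n + 2) ⊕ Fin (n + 2) → ℕ × ℕ :=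
  Sum.elim (fun _ => (1, 0)) (fun _ => (0, 1))

/-- The Zariski closure of a subset of `P^{n+1} × P^{n+1}`: the common zeros of all bihomogeneous
polynomials that vanish on it. -/
def zariskiClosureProd {n : ℕ} (S : Set (PSpace n × PSpace n)) : Set (PSpace n × PSpace n) :=
  {p | ∀ (d : ℕ × ℕ) (G : MvPolynomial (Fin (n + 2) ⊕ Fin (n + 2)) ℂ),
    IsWeightedHomogeneous (bidegree n) G d →
    (∀ q ∈ S, eval (Sum.elim q.1.rep q.2.rep) G = 0) → eval (Sum.elim p.1.rep p.2.rep) G = 0}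

/-- `x` is a smooth point of the hypersurface `{F = 0}` (`F` homogeneous and squarefree). -/
def IsSmoothPoint {n : ℕ} (F : MvPolynomial (Fin (n + 2)) ℂ) (x : PSpace n) : Prop :=
  x ∈ hypersurface F ∧ ∃ i, eval x.rep (pderiv i F) ≠ 0

/-- `x` is a point of affine space, that is, it does not lie at infinity. -/
def IsAffinePoint {n : ℕ} (x : PSpace n) : Prop :=
  ¬ x.submodule ≤ VInf n

/-- The projective tangent space of `{F = 0}` at the point `x`, as a vector subspace of `V`. -/
def tangentSpace {n : ℕ} (F : MvPolynomial (Fin (n + 2)) ℂ) (x : PSpace n) :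
    Submodule ℂ (Vec n) :=
  LinearMap.ker (∑ i, eval x.rep (pderiv i F) • (LinearMap.proj i : Vec n →ₗ[ℂ] ℂ))

/-- The annihilator in `V'` of the direction `L ∩ V'` of `L`, with respect to the quadratic form
`Q` on `V'`. -/
def orthogonalDirection {n : ℕ} (Q : QuadraticForm ℂ (VInf n)) (L : Submodule ℂ (Vec n)) :
    Submodule ℂ (VInf n) :=
  LinearMap.BilinForm.orthogonal Q.polarBilin (L.comap (VInf n).subtype)

/-- The orthogonal of `L` in the point `x`: the join of `x` with the orthogonal direction
of `L`. -/
def orthogonalAt {n : ℕ} (Q : QuadraticForm ℂ (VInf n)) (L : Submodule ℂ (Vec n))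
    (x : PSpace n) : Submodule ℂ (Vec n) :=
  x.submodule ⊔ (orthogonalDirection Q L).map (VInf n).subtype

/-- The normal space (here a line of `P^{n+1}`) of the hypersurface `{F = 0}` at `x`. -/
def normalSpace {n : ℕ} (Q : QuadraticForm ℂ (VInf n)) (F : MvPolynomial (Fin (n + 2)) ℂ)
    (x : PSpace n) : Submodule ℂ (Vec n) :=
  orthogonalAt Q (tangentSpace F x) x

/-- The pairs `(x, y)` with `x` a smooth point of `{F = 0}` not at infinity and `y` a point of the
normal space at `x`. -/
def goodNormalVariety {n : ℕ} (Q : QuadraticForm ℂ (VInf n))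
    (F : MvPolynomial (Fin (n + 2)) ℂ) : Set (PSpace n × PSpace n) :=
  {p | IsSmoothPoint F p.1 ∧ IsAffinePoint p.1 ∧ p.2.submodule ≤ normalSpace Q F p.1}

/-- The projective normal variety `N_X` of the hypersurface `X = {F = 0}`. -/
def normalVariety {n : ℕ} (Q : QuadraticForm ℂ (VInf n))
    (F : MvPolynomial (Fin (n + 2)) ℂ) : Set (PSpace n × PSpace n) :=
  zariskiClosureProd (goodNormalVariety Q F)

/-- The endpoint map, i.e. the second projection `N_X → P^{n+1}`. -/
def endpointMap {n : ℕ} (Q : QuadraticForm ℂ (VInf n)) (F : MvPolynomial (Fin (n + 2)) ℂ) :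
    normalVariety Q F → PSpace n :=
  fun p => p.1.2

/-- `X = {F = 0}` is isotropically focally degenerate: the endpoint map is not dominant. -/
def IsIsotropicallyFocallyDegenerate {n : ℕ} (Q : QuadraticForm ℂ (VInf n))
    (F : MvPolynomial (Fin (n + 2)) ℂ) : Prop :=
  zariskiClosure (Set.range (endpointMap Q F)) ≠ Set.univ

/-- `X = {F = 0}` is isotropically developable: for each smooth point `x` of `X` not at infinity
the normal line at `x` is contained in `X`, and at all smooth points `y` of `X` on this line the
tangent space of `X` is the same as at `x`. -/
def IsIsotropicallyDevelopable {n : ℕ} (Q : QuadraticForm ℂ (VInf n))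
    (F : MvPolynomial (Fin (n + 2)) ℂ) : Prop :=
  ∀ x : PSpace n, IsSmoothPoint F x → IsAffinePoint x →
    (∀ y : PSpace n, y.submodule ≤ normalSpace Q F x → y ∈ hypersurface F) ∧
    (∀ y : PSpace n, y.submodule ≤ normalSpace Q F x → IsSmoothPoint F y →
      tangentSpace F y = tangentSpace F x)

end

end FocalLoci

/-! Let ν be the gradient of F, raised to V' by the inverse of the polar form of Q, and let D = Σ
ν_j ∂_j. The normal line at x joins x to ν(x). Both properties are equivalent to F ∣ D F: along X
the normal direction is isotropic, hence tangent to X.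

If the endpoint map is not dominant, some nonzero G vanishes on all normal lines, and the
lowest-order term of G(x + tν) in t forces F ∣ D F (`dvd_mkDerivation_of_vanishing`).

If D F = hF, differentiating gives D(∂_i F) ≡ (h/2) ∂_i F mod F. So ν and the gradient only get
rescaled along the flow of ν, whose trajectories in X are thus straight lines with constant tangent
space (`eval_add_smul_gradientField`). The flow is replaced by a formal differential equation in t,
solved coefficientwise modulo F.

If X is developable, F itself vanishes on the image of the endpoint map. -/

namespace FocalLoci

open MvPolynomial LinearAlgebra.Projectivization

/-! ### Formal calculus along the lines x + tν(x). -/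

section Algebra

variable {σ : Type*}

/-- The restriction of polynomials to the generic line `x + t ν(x)`, as polynomials in `t`. -/
noncomputable def lineMap (ν : σ → MvPolynomial σ ℂ) :
    MvPolynomial σ ℂ →ₐ[ℂ] Polynomial (MvPolynomial σ ℂ) :=
  aeval fun j => Polynomial.C (X j) + Polynomial.X * Polynomial.C (ν j)

lemma lineMap_C (ν : σ → MvPolynomial σ ℂ) (a : ℂ) :
    lineMap ν (C a) = Polynomial.C (C a) := by
  simp only [lineMap, aeval_C]; rfl

lemma lineMap_X (ν : σ → MvPolynomial σ ℂ) (j : σ) :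
    lineMap ν (X j) = Polynomial.C (X j) + Polynomial.X * Polynomial.C (ν j) := by
  simp [lineMap]

lemma coeff_zero_lineMap (ν : σ → MvPolynomial σ ℂ) (P : MvPolynomial σ ℂ) :
    (lineMap ν P).coeff 0 = P := by
  induction P using MvPolynomial.induction_on with
  | C a => simp
  | add p q hp hq => simp [hp, hq]
  | mul_X p j hp => simp [Polynomial.mul_coeff_zero, hp, lineMap_X]

lemma coeff_one_lineMap (ν : σ → MvPolynomial σ ℂ) (P : MvPolynomial σ ℂ) :
    (lineMap ν P).coeff 1 = mkDerivation ℂ ν P := by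
  induction P using MvPolynomial.induction_on with
  | C a => simp
  | add p q hp hq => simp [hp, hq]
  | mul_X p j hp =>
    simp [Polynomial.mul_coeff_one, coeff_zero_lineMap, hp, lineMap_X, mkDerivation_X,
      Polynomial.coeff_C]
    ring

lemma eval_map_lineMap (ν : σ → MvPolynomial σ ℂ) (P : MvPolynomial σ ℂ) (v : σ → ℂ) (t : ℂ) :
    ((lineMap ν P).map (eval v)).eval t = eval (fun j => v j + t * eval v (ν j)) P := by
  induction P using MvPolynomial.induction_on with
  | C a => simp
  | add p q hp hq => simp [hp, hq]
  | mul_X p j hp => simp [hp, lineMap_X, mul_comm t]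

/-- The derivation `D - (1 + t b) ∂/∂t` of polynomials in `t`. -/
noncomputable def lineDerivation (ν : σ → MvPolynomial σ ℂ) (b : MvPolynomial σ ℂ) :
    Derivation ℂ (Polynomial (MvPolynomial σ ℂ)) (Polynomial (MvPolynomial σ ℂ)) :=
  PolynomialModule.equivPolynomialSelf.compDer (mkDerivation ℂ ν).mapCoeffs -
    (1 + Polynomial.X * Polynomial.C b) • Polynomial.derivative'.restrictScalars ℂ

lemma lineDerivation_apply (ν : σ → MvPolynomial σ ℂ) (b : MvPolynomial σ ℂ)
    (w : Polynomial (MvPolynomial σ ℂ)) :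
    lineDerivation ν b w = PolynomialModule.equivPolynomialSelf ((mkDerivation ℂ ν).mapCoeffs w) -
      (1 + Polynomial.X * Polynomial.C b) * Polynomial.derivative w := rfl

lemma lineDerivation_C (ν : σ → MvPolynomial σ ℂ) (b P : MvPolynomial σ ℂ) :
    lineDerivation ν b (Polynomial.C P) = Polynomial.C (mkDerivation ℂ ν P) := by
  simp [lineDerivation_apply]

lemma lineDerivation_X (ν : σ → MvPolynomial σ ℂ) (b : MvPolynomial σ ℂ) :
    lineDerivation ν b Polynomial.X = - (1 + Polynomial.X * Polynomial.C b) := by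
  simp [lineDerivation_apply]

lemma coeff_lineDerivation (ν : σ → MvPolynomial σ ℂ) (b : MvPolynomial σ ℂ)
    (w : Polynomial (MvPolynomial σ ℂ)) (k : ℕ) :
    (lineDerivation ν b w).coeff k =
      mkDerivation ℂ ν (w.coeff k) - (w.coeff (k + 1) * (k + 1) + b * (w.coeff k * k)) := by
  have h1 : (PolynomialModule.equivPolynomialSelf ((mkDerivation ℂ ν).mapCoeffs w)).coeff k =
      mkDerivation ℂ ν (w.coeff k) := rfl
  rw [lineDerivation_apply, Polynomial.coeff_sub, h1, add_mul, one_mul, Polynomial.coeff_add,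
    Polynomial.coeff_derivative, mul_assoc]
  congr 2
  cases k with
  | zero => simp
  | succ k => rw [Polynomial.coeff_X_mul, Polynomial.coeff_C_mul, Polynomial.coeff_derivative]; simp

/-- Along a vector field `ν` with `Dν ≡ bν mod F`, the derivation `lineDerivation` kills
restrictions to lines modulo `F`. -/
lemma C_dvd_lineDerivation_lineMap {ν : σ → MvPolynomial σ ℂ} {b F : MvPolynomial σ ℂ}
    (hν : ∀ j, F ∣ mkDerivation ℂ ν (ν j) - b * ν j) (P : MvPolynomial σ ℂ) :
    Polynomial.C F ∣ lineDerivation ν b (lineMap ν P) := by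
  induction P using MvPolynomial.induction_on with
  | C a => rw [lineMap_C, lineDerivation_C, derivation_C, map_zero]; exact dvd_zero _
  | add p q hp hq => simpa using dvd_add hp hq
  | mul_X p j hp =>
    rw [map_mul, Derivation.leibniz, smul_eq_mul, smul_eq_mul]
    refine dvd_add (Dvd.dvd.mul_left ?_ _) (Dvd.dvd.mul_left hp _)
    -- The factor 1 + tb is what makes D(x_j + tν_j) = ν_j + t Dν_j cancel against the ∂/∂t term, up
    -- to t(Dν_j - bν_j).
    have : lineDerivation ν b (lineMap ν (X j)) =
        Polynomial.X * Polynomial.C (mkDerivation ℂ ν (ν j) - b * ν j) := by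
      rw [lineMap_X, map_add, Derivation.leibniz, lineDerivation_C, lineDerivation_C,
        lineDerivation_X, mkDerivation_X]
      simp only [smul_eq_mul, map_sub, map_mul]
      ring
    rw [this]
    exact Dvd.dvd.mul_left (map_dvd Polynomial.C (hν j)) _

/-- Uniqueness of solutions of the differential equation `lineDerivation w = a w` modulo `F`. -/
lemma dvd_coeff_of_lineDerivation {ν : σ → MvPolynomial σ ℂ} {a b F : MvPolynomial σ ℂ}
    (hF : F ∣ mkDerivation ℂ ν F) {w : Polynomial (MvPolynomial σ ℂ)}
    (hw : Polynomial.C F ∣ lineDerivation ν b w - Polynomial.C a * w) (h0 : F ∣ w.coeff 0)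
    (k : ℕ) : F ∣ w.coeff k := by
  induction k with
  | zero => exact h0
  | succ k ih =>
    -- The t^k-coefficient reads (k+1) w_{k+1} ≡ D w_k - k b w_k - a w_k mod F, and D preserves the
    -- ideal (F) by `hF`.
    have h1 := Polynomial.C_dvd_iff_dvd_coeff _ _ |>.1 hw k
    rw [Polynomial.coeff_sub, coeff_lineDerivation, Polynomial.coeff_C_mul] at h1
    have h2 : F ∣ mkDerivation ℂ ν (w.coeff k) := by
      obtain ⟨u, hu⟩ := ih
      rw [hu, Derivation.leibniz, smul_eq_mul, smul_eq_mul]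
      exact dvd_add (dvd_mul_right _ _) (Dvd.dvd.mul_left hF _)
    have h3 : F ∣ w.coeff (k + 1) * (k + 1) := by
      have : w.coeff (k + 1) * (k + 1) = mkDerivation ℂ ν (w.coeff k) - b * (w.coeff k * k) -
          a * w.coeff k - (mkDerivation ℂ ν (w.coeff k) -
            (w.coeff (k + 1) * (k + 1) + b * (w.coeff k * k)) - a * w.coeff k) := by ring
      rw [this]
      exact dvd_sub (dvd_sub (dvd_sub h2 (Dvd.dvd.mul_left (Dvd.dvd.mul_right ih _) _))
        (Dvd.dvd.mul_left ih _)) h1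
    have h4 : w.coeff (k + 1) = w.coeff (k + 1) * ((k : MvPolynomial σ ℂ) + 1) * C ((k + 1 : ℂ)⁻¹) := by
      have : ((k : MvPolynomial σ ℂ) + 1) = C (k + 1 : ℂ) := by simp
      rw [this, mul_assoc, ← C_mul, mul_inv_cancel₀ (by exact_mod_cast Nat.succ_ne_zero k), C_1,
        mul_one]
    rw [h4]
    exact Dvd.dvd.mul_right h3 _

/-! ### From a polynomial vanishing on the lines to tangency of ν. -/

/-- A polynomial that vanishes on the zero set of an irreducible polynomial is divisible by it. -/
lemma dvd_of_forall_eval_eq_zero [Finite σ] {P K : MvPolynomial σ ℂ} (hP : Irreducible P)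
    (h : ∀ v : σ → ℂ, eval v P = 0 → eval v K = 0) : P ∣ K := by
  have hprime : (Ideal.span {P}).IsPrime :=
    (Ideal.span_singleton_prime hP.ne_zero).2 hP.prime
  rw [← Ideal.mem_span_singleton, ← IsPrime.vanishingIdeal_zeroLocus (K := ℂ) (Ideal.span {P}),
    mem_vanishingIdeal_iff]
  intro v hv
  rw [zeroLocus_span] at hv
  exact h v (by simpa using hv)

/-- A nonzero ∂_i P has smaller degree in x_i than P, so divisibility would kill all partials and,
in characteristic zero, make P constant. -/
lemma exists_not_dvd_pderiv {P : MvPolynomial σ ℂ} (hP : Irreducible P) :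
    ∃ i, ¬ P ∣ pderiv i P := by
  by_contra! hdvd
  have hzero : ∀ i, pderiv i P = 0 := by
    intro i
    by_contra hne
    obtain ⟨R, hR⟩ := hdvd i
    have hdeg := degreeOf_mul_eq hP.ne_zero (right_ne_zero_of_mul (hR ▸ hne)) (n := i)
    rw [← hR] at hdeg
    obtain ⟨m, hm, hmd⟩ : ∃ m ∈ (pderiv i P).support, m i = degreeOf i (pderiv i P) := by
      rw [degreeOf_eq_sup]
      obtain ⟨m, hm, h⟩ := Finset.exists_mem_eq_sup _
        (support_nonempty.2 hne) (fun m : σ →₀ ℕ => m i)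
      exact ⟨m, hm, h.symm⟩
    rw [mem_support_iff, coeff_pderiv] at hm
    have h1 := monomial_le_degreeOf i (mem_support_iff.2 (left_ne_zero_of_mul hm))
    simp at h1
    omega
  refine hP.not_isUnit ?_
  have hC : P = C (coeff 0 P) := by
    classical
    ext m
    rw [coeff_C]
    split_ifs with h
    · rw [h]
    · obtain ⟨i, hi⟩ := Finsupp.ne_iff.1 (Ne.symm h)
      have h1 := coeff_pderiv (i := i) P (m - Finsupp.single i 1)
      rw [hzero i, coeff_zero, tsub_add_cancel_of_le
        (Finsupp.single_le_iff.2 (Nat.one_le_iff_ne_zero.2 hi))] at h1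
      exact (mul_eq_zero.1 h1.symm).resolve_right (Nat.cast_add_one_ne_zero _)
  rw [hC]
  refine (IsUnit.mk0 _ fun h => hP.ne_zero ?_).map C
  rw [hC, h, C_0]

lemma dvd_of_forall_irreducible_dvd {F K : MvPolynomial σ ℂ} (hsq : Squarefree F)
    (h : ∀ P, Irreducible P → P ∣ F → P ∣ K) : F ∣ K := by
  induction F using WfDvdMonoid.induction_on_irreducible with
  | zero => exact absurd hsq not_squarefree_zero
  | unit u hu => exact hu.dvd
  | mul a i _ hi ih =>
    obtain ⟨hrel, -, ha⟩ := squarefree_mul_iff.1 hsq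
    exact hrel.mul_dvd (h i hi (dvd_mul_right _ _))
      (ih ha fun P hP hPa => h P hP (hPa.mul_left _))

/-- If a nonzero polynomial vanishes on the lines `x + t ν(x)` attached to the points `x` of the
hypersurface `F = 0` with `L(x) ≠ 0` and nonzero gradient, then `ν` is tangent to `F = 0`. -/
lemma dvd_mkDerivation_of_vanishing [Finite σ] {F G L : MvPolynomial σ ℂ}
    {ν : σ → MvPolynomial σ ℂ} (hsq : Squarefree F) (hL : ∀ P, Irreducible P → P ∣ F → ¬ P ∣ L)
    (hG : G ≠ 0)
    (h : ∀ (v : σ → ℂ) (i : σ), eval v F = 0 → eval v L ≠ 0 → eval v (pderiv i F) ≠ 0 →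
      ∀ t : ℂ, eval (fun j => v j + t * eval v (ν j)) G = 0) :
    F ∣ mkDerivation ℂ ν F := by
  refine dvd_of_forall_irreducible_dvd hsq fun P hP hPF => ?_
  obtain ⟨R, hR⟩ := hPF
  have hPR : ¬ P ∣ R := fun hdvd => hP.not_isUnit <| hsq P <| hR ▸ mul_dvd_mul_left P hdvd
  obtain ⟨i, hi⟩ := exists_not_dvd_pderiv hP
  have hiF : ¬ P ∣ pderiv i F := by
    rw [hR, Derivation.leibniz, smul_eq_mul, smul_eq_mul, dvd_add_right (dvd_mul_right _ _)]
    exact fun hdvd => (hP.prime.dvd_or_dvd hdvd).elim hPR hi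
  obtain ⟨k, H, hH, rfl⟩ := WfDvdMonoid.max_power_factor hG hP
  -- On P = 0 one has P(x + tν) = t(DP + ...), so the t^k-coefficient of the restricted P^k H is
  -- (DP)^k H. The factor L ∂_i F absorbs the points where the lines are not controlled.
  have hK : P ∣ mkDerivation ℂ ν P ^ k * H * (L * pderiv i F) := by
    refine dvd_of_forall_eval_eq_zero hP fun v hv => ?_
    by_cases hv1 : eval v L = 0
    · simp [hv1]
    by_cases hv2 : eval v (pderiv i F) = 0
    · simp [hv2]
    have hzero : (lineMap ν (P ^ k * H)).map (eval v) = 0 := by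
      refine Polynomial.funext fun t => ?_
      rw [eval_map_lineMap, Polynomial.eval_zero]
      exact h v i (by rw [hR, map_mul, hv, zero_mul]) hv1 hv2 t
    obtain ⟨q, hq⟩ : Polynomial.X ∣ (lineMap ν P).map (eval v) := by
      rw [Polynomial.X_dvd_iff, Polynomial.coeff_map, coeff_zero_lineMap, hv]
    have hq0 : q.coeff 0 = eval v (mkDerivation ℂ ν P) := by
      rw [← coeff_one_lineMap, ← Polynomial.coeff_map, hq, Polynomial.coeff_X_mul]
    rw [map_mul, map_pow, Polynomial.map_mul, Polynomial.map_pow, hq, mul_pow, mul_assoc,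
      mul_eq_zero, or_iff_right (pow_ne_zero _ Polynomial.X_ne_zero)] at hzero
    have h0 := congrArg Polynomial.constantCoeff hzero
    simp only [map_mul, map_pow, Polynomial.constantCoeff_apply, hq0, Polynomial.coeff_map,
      coeff_zero_lineMap, Polynomial.coeff_zero] at h0
    rw [map_mul, map_mul, map_pow, h0, zero_mul]
  have hDP : P ∣ mkDerivation ℂ ν P := by
    rcases hP.prime.dvd_or_dvd hK with h1 | h1
    · rcases hP.prime.dvd_or_dvd h1 with h2 | h2
      · exact hP.prime.dvd_of_dvd_pow h2
      · exact absurd h2 hH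
    · exact ((hP.prime.dvd_or_dvd h1).elim (hL P hP (hR ▸ dvd_mul_right _ _)) hiF).elim
  rw [hR, Derivation.leibniz, smul_eq_mul, smul_eq_mul]
  exact dvd_add (dvd_mul_right _ _) (Dvd.dvd.mul_left hDP _)

/-! ### Gradient fields tangent to the hypersurface. -/

/-- The gradient of `F` with respect to the (dual) bilinear form with matrix `g`. -/
noncomputable def gradientField [Fintype σ] (g : σ → σ → ℂ) (F : MvPolynomial σ ℂ) (j : σ) :
    MvPolynomial σ ℂ :=
  ∑ i, C (g i j) * pderiv i F

lemma mkDerivation_eq_sum [Fintype σ] (ν : σ → MvPolynomial σ ℂ) (P : MvPolynomial σ ℂ) :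
    mkDerivation ℂ ν P = ∑ j, ν j * pderiv j P := by
  classical
  have hsum : ∀ P, (∑ j, ν j • pderiv j : Derivation ℂ (MvPolynomial σ ℂ) _) P =
      ∑ j, ν j * pderiv j P := fun P => by
    rw [← Derivation.coeFnAddMonoidHom_apply, map_sum, Finset.sum_apply]
    rfl
  rw [← hsum]
  congr 1
  refine derivation_ext fun i => ?_
  rw [mkDerivation_X, hsum]
  simp [pderiv_X, Pi.single_apply]

lemma pderiv_comm (i j : σ) (P : MvPolynomial σ ℂ) :
    pderiv i (pderiv j P) = pderiv j (pderiv i P) := by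
  classical
  have : (⁅(pderiv i : Derivation ℂ (MvPolynomial σ ℂ) (MvPolynomial σ ℂ)),
      (pderiv j : Derivation ℂ (MvPolynomial σ ℂ) (MvPolynomial σ ℂ))⁆) = 0 := by
    refine derivation_ext fun k => ?_
    rw [Derivation.commutator_apply]
    simp only [pderiv_X, Pi.single_apply]
    split_ifs <;> simp
  have h := DFunLike.congr_fun this P
  rwa [Derivation.commutator_apply, Derivation.zero_apply, sub_eq_zero] at h

/-- D F is the quadratic form g in the partials of F; by symmetry both factors contribute equally to
its derivative. -/
lemma pderiv_mkDerivation_gradientField [Fintype σ] {g : σ → σ → ℂ} (hg : ∀ i j, g i j = g j i)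
    (F : MvPolynomial σ ℂ) (i : σ) :
    pderiv i (mkDerivation ℂ (gradientField g F) F) =
      2 * mkDerivation ℂ (gradientField g F) (pderiv i F) := by
  have h1 : ∑ j, pderiv i (gradientField g F j) * pderiv j F =
      ∑ j, gradientField g F j * pderiv i (pderiv j F) := by
    simp only [gradientField, map_sum, pderiv_C_mul, Finset.sum_mul]
    rw [Finset.sum_comm]
    refine Finset.sum_congr rfl fun j _ => Finset.sum_congr rfl fun k _ => ?_
    rw [hg j k]
    ring
  simp only [mkDerivation_eq_sum, map_sum, Derivation.leibniz, smul_eq_mul,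
    Finset.sum_add_distrib]
  have h2 : ∑ j, pderiv j F * pderiv i (gradientField g F j) =
      ∑ j, gradientField g F j * pderiv i (pderiv j F) := by
    rw [← h1]; exact Finset.sum_congr rfl fun j _ => mul_comm _ _
  rw [h2, two_mul]
  refine congrArg₂ (· + ·) (Finset.sum_congr rfl fun j _ => ?_) (Finset.sum_congr rfl fun j _ => ?_)
  all_goals rw [pderiv_comm]

/-- If the gradient field `ν` is tangent to `F = 0`, then the lines `x + t ν(x)` are contained in
`F = 0`, and the gradient of `F` has constant direction along them. -/
lemma eval_add_smul_gradientField [Fintype σ] {g : σ → σ → ℂ} (hg : ∀ i j, g i j = g j i)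
    {F : MvPolynomial σ ℂ} (hF : F ∣ mkDerivation ℂ (gradientField g F) F) {v : σ → ℂ}
    (hv : eval v F = 0) (t : ℂ) :
    eval (fun j => v j + t * eval v (gradientField g F j)) F = 0 ∧
    ∀ i k, eval v (pderiv i F) *
        eval (fun j => v j + t * eval v (gradientField g F j)) (pderiv k F) =
      eval v (pderiv k F) *
        eval (fun j => v j + t * eval v (gradientField g F j)) (pderiv i F) := by
  set ν := gradientField g F with hνdef
  obtain ⟨h, hh⟩ := hF
  -- The half compensates the 2 in ∂_i(D F) = 2 D(∂_i F).
  set b : MvPolynomial σ ℂ := C (1 / 2) * h with hb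
  have h2 : (C (1 / 2) * 2 : MvPolynomial σ ℂ) = 1 := by
    rw [← map_ofNat C 2, ← C_mul]; simp
  have hgrad : ∀ i, F ∣ mkDerivation ℂ ν (pderiv i F) - b * pderiv i F := by
    intro i
    refine ⟨C (1 / 2) * pderiv i h, ?_⟩
    have h1 := pderiv_mkDerivation_gradientField hg F i
    rw [← hνdef, hh, Derivation.leibniz, smul_eq_mul, smul_eq_mul] at h1
    linear_combination (-C (1 / 2)) * h1 - mkDerivation ℂ ν (pderiv i F) * h2
  have hν : ∀ j, F ∣ mkDerivation ℂ ν (ν j) - b * ν j := by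
    intro j
    have h1 : mkDerivation ℂ ν (ν j) - b * ν j =
        ∑ i, C (g i j) * (mkDerivation ℂ ν (pderiv i F) - b * pderiv i F) := by
      conv_lhs => rw [show ν j = ∑ i, C (g i j) * pderiv i F from rfl]
      rw [map_sum, Finset.mul_sum, ← Finset.sum_sub_distrib]
      refine Finset.sum_congr rfl fun i _ => ?_
      rw [Derivation.leibniz, derivation_C]
      simp only [smul_eq_mul]
      ring
    rw [h1]
    exact Finset.dvd_sum fun i _ => Dvd.dvd.mul_left (hgrad i) _
  have key : ∀ (a : MvPolynomial σ ℂ) (w : Polynomial (MvPolynomial σ ℂ)),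
      Polynomial.C F ∣ lineDerivation ν b w - Polynomial.C a * w → F ∣ w.coeff 0 →
      ∀ t, (w.map (eval v)).eval t = 0 := by
    intro a w hw h0 t
    have : w.map (eval v) = 0 := by
      ext k
      obtain ⟨u, hu⟩ := dvd_coeff_of_lineDerivation ⟨h, hh⟩ hw h0 k
      rw [Polynomial.coeff_map, hu, map_mul, hv, zero_mul, Polynomial.coeff_zero]
    rw [this, Polynomial.eval_zero]
  constructor
  · rw [← eval_map_lineMap]
    refine key 0 _ ?_ (by rw [coeff_zero_lineMap]) t
    simpa using C_dvd_lineDerivation_lineMap hν F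
  · intro i k
    -- Each 2×2 minor of the gradients at x and x + tν vanishes at t = 0. Modulo F, `lineDerivation`
    -- kills the factor at x + tν and multiplies the one at x by b, so `key` applies with a = b.
    have h1 := key b (Polynomial.C (pderiv i F) * lineMap ν (pderiv k F) -
      Polynomial.C (pderiv k F) * lineMap ν (pderiv i F)) ?_ ?_ t
    · simpa [eval_map_lineMap, sub_eq_zero] using h1
    · have h1 : ∀ i k, Polynomial.C F ∣ lineDerivation ν b
          (Polynomial.C (pderiv i F) * lineMap ν (pderiv k F)) -
          Polynomial.C b * (Polynomial.C (pderiv i F) * lineMap ν (pderiv k F)) := by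
        intro i k
        have : lineDerivation ν b (Polynomial.C (pderiv i F) * lineMap ν (pderiv k F)) -
            Polynomial.C b * (Polynomial.C (pderiv i F) * lineMap ν (pderiv k F)) =
            Polynomial.C (pderiv i F) * lineDerivation ν b (lineMap ν (pderiv k F)) +
            Polynomial.C (mkDerivation ℂ ν (pderiv i F) - b * pderiv i F) *
              lineMap ν (pderiv k F) := by
          rw [Derivation.leibniz, lineDerivation_C]
          simp only [smul_eq_mul, map_sub, map_mul]
          ring
        rw [this]
        exact dvd_add (Dvd.dvd.mul_left (C_dvd_lineDerivation_lineMap hν _) _)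
          (Dvd.dvd.mul_right (map_dvd Polynomial.C (hgrad i)) _)
      rw [map_sub, mul_sub, sub_sub_sub_comm]
      exact dvd_sub (h1 i k) (h1 k i)
    · rw [Polynomial.coeff_sub, Polynomial.coeff_C_mul, Polynomial.coeff_C_mul, coeff_zero_lineMap,
        coeff_zero_lineMap, mul_comm, sub_self]
      exact dvd_zero _

end Algebra

/-! ### Homogeneity, representatives and normal lines in coordinates. -/

section Homogeneous

variable {σ : Type*}

lemma eval_smul_of_isHomogeneous {P : MvPolynomial σ ℂ} {e : ℕ} (hP : P.IsHomogeneous e) (a : ℂ)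
    (v : σ → ℂ) : eval (a • v) P = a ^ e * eval v P := by
  rw [eval_eq, eval_eq, Finset.mul_sum]
  refine Finset.sum_congr rfl fun m hm => ?_
  have hdeg : ∑ i ∈ m.support, m i = e := by
    rw [← Finsupp.degree_apply, Finsupp.degree_eq_weight_one]
    exact hP (mem_support_iff.1 hm)
  simp only [Pi.smul_apply, smul_eq_mul, mul_pow, Finset.prod_mul_distrib, Finset.prod_pow_eq_pow_sum,
    hdeg]
  ring

end Homogeneous

variable {n : ℕ}

lemma isWeightedHomogeneous_rename_inr {P : MvPolynomial (Fin (n + 2)) ℂ} {e : ℕ}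
    (hP : P.IsHomogeneous e) :
    IsWeightedHomogeneous (bidegree n) (rename Sum.inr P) (0, e) := by
  intro m hm
  obtain ⟨u, rfl, hu⟩ := coeff_rename_ne_zero _ _ _ hm
  have hdeg := hP hu
  rw [Finsupp.weight_apply] at hdeg ⊢
  rw [Finsupp.sum_mapDomain_index (by simp) (by simp [add_smul])]
  rw [← hdeg]
  simp [bidegree, Finsupp.sum, Prod.ext_iff, Prod.fst_sum, Prod.snd_sum]

/-- One scalar serves all P, so all partials of F rescale by a common factor. -/
lemma exists_eval_rep_mk (v : Vec n) (hv : v ≠ 0) : ∃ a : ℂ, a ≠ 0 ∧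
    ∀ (P : MvPolynomial (Fin (n + 2)) ℂ) (e : ℕ), P.IsHomogeneous e →
      eval (Projectivization.mk ℂ v hv).rep P = a ^ e * eval v P := by
  obtain ⟨a, ha⟩ := Projectivization.exists_smul_eq_mk_rep ℂ v hv
  refine ⟨a, a.ne_zero, fun P e hP => ?_⟩
  rw [← ha]
  exact eval_smul_of_isHomogeneous hP _ _

lemma eval_rep_mk_eq_zero_iff {P : MvPolynomial (Fin (n + 2)) ℂ} {e : ℕ} (hP : P.IsHomogeneous e)
    (v : Vec n) (hv : v ≠ 0) :
    eval (Projectivization.mk ℂ v hv).rep P = 0 ↔ eval v P = 0 := by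
  obtain ⟨a, ha, h⟩ := exists_eval_rep_mk v hv
  simp [h P e hP, ha]

lemma isSmoothPoint_mk {F : MvPolynomial (Fin (n + 2)) ℂ} {d : ℕ} (hF : F.IsHomogeneous d)
    (v : Vec n) (hv : v ≠ 0) : IsSmoothPoint F (Projectivization.mk ℂ v hv) ↔
      eval v F = 0 ∧ ∃ i, eval v (pderiv i F) ≠ 0 := by
  simp only [IsSmoothPoint, hypersurface, Set.mem_ofPred_eq, ne_eq, eval_rep_mk_eq_zero_iff hF,
    eval_rep_mk_eq_zero_iff hF.pderiv]

lemma isAffinePoint_mk (v : Vec n) (hv : v ≠ 0) :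
    IsAffinePoint (Projectivization.mk ℂ v hv) ↔ v 0 ≠ 0 := by
  simp [IsAffinePoint, Projectivization.submodule_mk]

/-- The differential of `F` at `v`. -/
noncomputable def differential (F : MvPolynomial (Fin (n + 2)) ℂ) (v : Vec n) :
    Vec n →ₗ[ℂ] ℂ :=
  ∑ i, eval v (pderiv i F) • (LinearMap.proj i : Vec n →ₗ[ℂ] ℂ)

lemma tangentSpace_mk {F : MvPolynomial (Fin (n + 2)) ℂ} {d : ℕ} (hF : F.IsHomogeneous d)
    (v : Vec n) (hv : v ≠ 0) :
    tangentSpace F (Projectivization.mk ℂ v hv) = LinearMap.ker (differential F v) := by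
  obtain ⟨a, ha, h⟩ := exists_eval_rep_mk v hv
  have : ∑ i, eval (Projectivization.mk ℂ v hv).rep (pderiv i F) •
      (LinearMap.proj i : Vec n →ₗ[ℂ] ℂ) = a ^ (d - 1) • differential F v := by
    simp only [differential, Finset.smul_sum, smul_smul, h _ _ hF.pderiv]
  rw [tangentSpace, this, LinearMap.ker_smul _ _ (pow_ne_zero _ ha)]

variable {Q : QuadraticForm ℂ (VInf n)}

/-- The vector of `V'` that represents the `i`-th coordinate function with respect to `Q`. -/
noncomputable def dualVec (hQ : Q.polarBilin.Nondegenerate) (i : Fin (n + 2)) : VInf n :=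
  (LinearMap.BilinForm.toDual Q.polarBilin hQ).symm
    ((LinearMap.proj i : Vec n →ₗ[ℂ] ℂ) ∘ₗ (VInf n).subtype)

lemma polarBilin_dualVec (hQ : Q.polarBilin.Nondegenerate) (i : Fin (n + 2)) (m : VInf n) :
    Q.polarBilin (dualVec hQ i) m = (m : Vec n) i := by
  rw [dualVec, LinearMap.BilinForm.apply_toDual_symm_apply]
  rfl

lemma polarBilin_comm (m m' : VInf n) : Q.polarBilin m m' = Q.polarBilin m' m := by
  simp [QuadraticMap.polar_comm]

/-- The matrix of the form on the dual space of `V'` that is inverse to `Q`. -/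
noncomputable def dualMatrix (hQ : Q.polarBilin.Nondegenerate) (i j : Fin (n + 2)) : ℂ :=
  (dualVec hQ i : Vec n) j

/-- Both entries are the pairing of the i-th and j-th dual vectors. -/
lemma dualMatrix_comm (hQ : Q.polarBilin.Nondegenerate) (i j : Fin (n + 2)) :
    dualMatrix hQ i j = dualMatrix hQ j i := by
  rw [dualMatrix, dualMatrix, ← polarBilin_dualVec hQ, ← polarBilin_dualVec hQ, polarBilin_comm]

/-- The gradient of `F` at `v` with respect to `Q`. -/
noncomputable def gradient (hQ : Q.polarBilin.Nondegenerate) (F : MvPolynomial (Fin (n + 2)) ℂ)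
    (v : Vec n) : VInf n :=
  ∑ i, eval v (pderiv i F) • dualVec hQ i

lemma coe_gradient (hQ : Q.polarBilin.Nondegenerate) (F : MvPolynomial (Fin (n + 2)) ℂ)
    (v : Vec n) (j : Fin (n + 2)) :
    (gradient hQ F v : Vec n) j = eval v (gradientField (dualMatrix hQ) F j) := by
  simp [gradient, gradientField, dualMatrix, mul_comm]

lemma polarBilin_gradient (hQ : Q.polarBilin.Nondegenerate) (F : MvPolynomial (Fin (n + 2)) ℂ)
    (v : Vec n) (m : VInf n) :
    Q.polarBilin (gradient hQ F v) m = differential F v m := by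
  simp only [gradient, differential, map_sum, LinearMap.sum_apply, map_smul, LinearMap.smul_apply,
    polarBilin_dualVec, LinearMap.proj_apply]

lemma orthogonalDirection_ker_differential (hQ : Q.polarBilin.Nondegenerate)
    (F : MvPolynomial (Fin (n + 2)) ℂ) (v : Vec n) :
    orthogonalDirection Q (LinearMap.ker (differential F v)) =
      Submodule.span ℂ {gradient hQ F v} := by
  ext m
  rw [orthogonalDirection, LinearMap.BilinForm.mem_orthogonal_iff, Submodule.mem_span_singleton]
  constructor
  · intro h
    -- A functional vanishing on the kernel of another is a multiple of it; this also covers a zero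
    -- gradient.
    have hspan := mem_span_of_iInf_ker_le_ker (ι := Unit)
      (L := fun _ => Q.polarBilin (gradient hQ F v)) (K := Q.polarBilin m) (by
        intro u hu
        rw [iInf_const, LinearMap.mem_ker, polarBilin_gradient] at hu
        rw [LinearMap.mem_ker, polarBilin_comm]
        exact h u (by simpa using hu))
    rw [Set.range_const, Submodule.mem_span_singleton] at hspan
    obtain ⟨t, ht⟩ := hspan
    refine ⟨t, (LinearMap.BilinForm.toDual Q.polarBilin hQ).injective ?_⟩
    rw [map_smul]
    exact ht
  · rintro ⟨t, rfl⟩ u hu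
    have hu' : differential F v u = 0 := by simpa using hu
    rw [map_smul, polarBilin_comm, polarBilin_gradient, hu', smul_zero]

lemma mem_normalSpace_mk (hQ : Q.polarBilin.Nondegenerate) {F : MvPolynomial (Fin (n + 2)) ℂ}
    {d : ℕ} (hF : F.IsHomogeneous d) (v : Vec n) (hv : v ≠ 0) (w : Vec n) :
    w ∈ normalSpace Q F (Projectivization.mk ℂ v hv) ↔
      ∃ s t : ℂ, s • v + t • (gradient hQ F v : Vec n) = w := by
  rw [normalSpace, orthogonalAt, tangentSpace_mk hF, orthogonalDirection_ker_differential hQ,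
    Projectivization.submodule_mk, Submodule.map_span, Set.image_singleton, Submodule.mem_sup]
  simp [Submodule.mem_span_singleton]

lemma eq_zero_of_continuous {f : ℂ → ℂ} (hf : Continuous f) (h : ∀ s, s ≠ 0 → f s = 0) (s : ℂ) :
    f s = 0 :=
  congrFun (Continuous.ext_on (dense_compl_singleton 0) hf continuous_const
    fun s hs => h s hs) s

/-- Properties of the points on the normal lines if the gradient is isotropic. -/
lemma eval_smul_add_smul_gradient (hQ : Q.polarBilin.Nondegenerate)
    {F : MvPolynomial (Fin (n + 2)) ℂ} {d : ℕ} (hF : F.IsHomogeneous d)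
    (htan : F ∣ mkDerivation ℂ (gradientField (dualMatrix hQ) F) F) {v : Vec n}
    (hv : eval v F = 0) (s t : ℂ) :
    eval (s • v + t • (gradient hQ F v : Vec n)) F = 0 ∧
    ∀ i k, eval v (pderiv i F) * eval (s • v + t • (gradient hQ F v : Vec n)) (pderiv k F) =
      eval v (pderiv k F) * eval (s • v + t • (gradient hQ F v : Vec n)) (pderiv i F) := by
  have hline : ∀ s, s ≠ 0 → s • v + t • (gradient hQ F v : Vec n) = s • fun j =>
      v j + s⁻¹ * t * eval v (gradientField (dualMatrix hQ) F j) := by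
    intro s hs
    ext j
    simp only [Pi.add_apply, Pi.smul_apply, smul_eq_mul, coe_gradient]
    field_simp
  -- The remaining point s = 0 of the line lies at infinity and is reached by letting s tend to 0.
  have hcont : ∀ P : MvPolynomial (Fin (n + 2)) ℂ,
      Continuous fun s : ℂ => eval (s • v + t • (gradient hQ F v : Vec n)) P := fun P =>
    P.continuous_eval.comp (by fun_prop)
  constructor
  · refine eq_zero_of_continuous (hcont F) (fun s hs => ?_) s
    rw [hline s hs, eval_smul_of_isHomogeneous hF,
      (eval_add_smul_gradientField (dualMatrix_comm hQ) htan hv _).1, mul_zero]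
  · intro i k
    rw [← sub_eq_zero]
    refine eq_zero_of_continuous (((hcont _).const_mul _).sub ((hcont _).const_mul _))
      (fun s hs => ?_) s
    rw [Pi.sub_apply, hline s hs, eval_smul_of_isHomogeneous hF.pderiv, eval_smul_of_isHomogeneous hF.pderiv]
    linear_combination s ^ (d - 1) *
      (eval_add_smul_gradientField (dualMatrix_comm hQ) htan hv (s⁻¹ * t)).2 i k

lemma ker_differential_eq {F : MvPolynomial (Fin (n + 2)) ℂ} {v w : Vec n}
    (h : ∀ i k, eval v (pderiv i F) * eval w (pderiv k F) =
      eval v (pderiv k F) * eval w (pderiv i F))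
    (hv : ∃ i, eval v (pderiv i F) ≠ 0) (hw : ∃ i, eval w (pderiv i F) ≠ 0) :
    LinearMap.ker (differential F w) = LinearMap.ker (differential F v) := by
  obtain ⟨i, hi⟩ := hv
  obtain ⟨k, hk⟩ := hw
  have hwi : eval w (pderiv i F) ≠ 0 := by
    intro h0
    have := h i k
    rw [h0, mul_zero] at this
    exact mul_ne_zero hi hk this
  have : differential F w =
      (eval w (pderiv i F) / eval v (pderiv i F)) • differential F v := by
    simp only [differential, Finset.smul_sum, smul_smul]
    refine Finset.sum_congr rfl fun k _ => ?_
    congr 1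
    field_simp
    linear_combination h i k
  rw [this, LinearMap.ker_smul _ _ (div_ne_zero hwi hi)]

/-! ### The implications between degeneracy, F ∣ D F and developability. -/

lemma subset_normalVariety (F : MvPolynomial (Fin (n + 2)) ℂ) :
    goodNormalVariety Q F ⊆ normalVariety Q F :=
  fun p hp _ _ _ h => h p hp

lemma isIsotropicallyFocallyDegenerate_of_developable {F : MvPolynomial (Fin (n + 2)) ℂ} {d : ℕ}
    (hd : 0 < d) (hF : F.IsHomogeneous d) (hF0 : F ≠ 0) (h : IsIsotropicallyDevelopable Q F) :
    IsIsotropicallyFocallyDegenerate Q F := by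
  obtain ⟨v, hv⟩ : ∃ v, eval v F ≠ 0 := by
    by_contra! hzero
    exact hF0 (MvPolynomial.funext fun v => by rw [hzero, map_zero])
  have hv0 : v ≠ 0 := by
    rintro rfl
    refine hv ?_
    have := eval_smul_of_isHomogeneous hF 0 0
    rwa [zero_smul, zero_pow hd.ne', zero_mul] at this
  intro huniv
  have hmem : Projectivization.mk ℂ v hv0 ∈ zariskiClosure (Set.range (endpointMap Q F)) :=
    huniv ▸ Set.mem_univ _
  refine hv ((eval_rep_mk_eq_zero_iff hF v hv0).1 (hmem d F hF ?_))
  rintro _ ⟨⟨p, hp⟩, rfl⟩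
  -- F(y), of bidegree (0, d), vanishes on the good pairs, hence on their closure.
  have := hp (0, d) (rename Sum.inr F) (isWeightedHomogeneous_rename_inr hF) fun q hq => by
    rw [eval_rename, Sum.elim_comp_inr]
    exact (h q.1 hq.1 hq.2.1).1 q.2 hq.2.2
  rwa [eval_rename, Sum.elim_comp_inr] at this

lemma dvd_of_isIsotropicallyFocallyDegenerate (hQ : Q.polarBilin.Nondegenerate)
    {F : MvPolynomial (Fin (n + 2)) ℂ} {d : ℕ} (hF : F.IsHomogeneous d) (hsq : Squarefree F)
    (hinf : ¬ X 0 ∣ F) (h : IsIsotropicallyFocallyDegenerate Q F) :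
    F ∣ mkDerivation ℂ (gradientField (dualMatrix hQ) F) F := by
  obtain ⟨z, hz⟩ := (Set.ne_univ_iff_exists_notMem _).1 h
  simp only [zariskiClosure, Set.mem_ofPred_eq, not_forall] at hz
  obtain ⟨e, G, hG, hvan, hGz⟩ := hz
  -- Normal lines are available only at affine points, hence L = x_0, which no factor of F divides.
  refine dvd_mkDerivation_of_vanishing (L := X 0) hsq ?_ (by rintro rfl; simp at hGz) ?_ (G := G)
  · intro P hP hPF hPX
    have hass := hP.associated_of_dvd (X_prime (R := ℂ) (i := 0)).irreducible hPX
    exact hinf (hass.symm.dvd.trans hPF)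
  · intro v i hv hv0 hvi t
    rw [eval_X] at hv0
    have hvne : v ≠ 0 := by rintro rfl; exact hv0 rfl
    set w : Vec n := v + t • (gradient hQ F v : Vec n) with hw
    have hgrad0 : (gradient hQ F v : Vec n) 0 = 0 := (gradient hQ F v).2
    have hwne : w ≠ 0 := by
      intro h0
      have := congrFun h0 0
      rw [hw, Pi.add_apply, Pi.smul_apply, hgrad0, smul_zero, add_zero] at this
      exact hv0 this
    have hgood : (Projectivization.mk ℂ v hvne, Projectivization.mk ℂ w hwne) ∈
        goodNormalVariety Q F := by
      refine ⟨(isSmoothPoint_mk hF v hvne).2 ⟨hv, i, hvi⟩, (isAffinePoint_mk v hvne).2 hv0, ?_⟩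
      rw [Projectivization.submodule_mk, Submodule.span_singleton_le_iff_mem,
        mem_normalSpace_mk hQ hF]
      exact ⟨1, t, by rw [one_smul]⟩
    have h1 := (eval_rep_mk_eq_zero_iff hG w hwne).1
      (hvan _ ⟨⟨_, subset_normalVariety F hgood⟩, rfl⟩)
    have h2 : w = fun j => v j + t * eval v (gradientField (dualMatrix hQ) F j) := by
      ext j
      rw [hw, Pi.add_apply, Pi.smul_apply, coe_gradient, smul_eq_mul]
    rwa [h2] at h1

lemma isIsotropicallyDevelopable_of_dvd (hQ : Q.polarBilin.Nondegenerate)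
    {F : MvPolynomial (Fin (n + 2)) ℂ} {d : ℕ} (hF : F.IsHomogeneous d)
    (htan : F ∣ mkDerivation ℂ (gradientField (dualMatrix hQ) F) F) :
    IsIsotropicallyDevelopable Q F := by
  intro x hx _
  induction x using Projectivization.ind with | _ v hv
  rw [isSmoothPoint_mk hF] at hx
  have hline : ∀ (w : Vec n) (hw : w ≠ 0), (Projectivization.mk ℂ w hw).submodule ≤
      normalSpace Q F (Projectivization.mk ℂ v hv) →
      ∃ s t : ℂ, s • v + t • (gradient hQ F v : Vec n) = w := fun w hw h => by
    rwa [Projectivization.submodule_mk, Submodule.span_singleton_le_iff_mem,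
      mem_normalSpace_mk hQ hF] at h
  refine ⟨fun y hy => ?_, fun y hy hsm => ?_⟩
  · induction y using Projectivization.ind with | _ w hw
    obtain ⟨s, t, rfl⟩ := hline w hw hy
    exact (eval_rep_mk_eq_zero_iff hF _ hw).2
      (eval_smul_add_smul_gradient hQ hF htan hx.1 s t).1
  · induction y using Projectivization.ind with | _ w hw
    obtain ⟨s, t, rfl⟩ := hline w hw hy
    rw [tangentSpace_mk hF, tangentSpace_mk hF]
    exact ker_differential_eq (eval_smul_add_smul_gradient hQ hF htan hx.1 s t).2 hx.2
      ((isSmoothPoint_mk hF _ hw).1 hsm).2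

end FocalLoci

theorem theorem4 (n : ℕ) (Q : QuadraticForm ℂ (FocalLoci.VInf n))
    (hQ : Q.polarBilin.Nondegenerate)
    (F : MvPolynomial (Fin (n + 2)) ℂ) (d : ℕ) (hd : 0 < d) (hF : F.IsHomogeneous d)
    (hsq : Squarefree F) (hinf : ¬ MvPolynomial.X 0 ∣ F) :
    FocalLoci.IsIsotropicallyFocallyDegenerate Q F ↔
      FocalLoci.IsIsotropicallyDevelopable Q F :=
  ⟨fun h => FocalLoci.isIsotropicallyDevelopable_of_dvd hQ hF
      (FocalLoci.dvd_of_isIsotropicallyFocallyDegenerate hQ hF hsq hinf h),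
    FocalLoci.isIsotropicallyFocallyDegenerate_of_developable hd hF hsq.ne_zero⟩
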